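/- Let $\mathcal B$ be a small category, let $\mathcal G=\mathrm{Set}^{\mathcal B}$ be the category of functors $\mathcal B\to\mathrm{Set}$, and let $I$ be a finite directed multigraph (finitely many vertices and edges). A diagram $D:I\to\mathcal G$ assigns to each vertex $i$ an object $D_i$ of $\mathcal G$ and to each edge $d:i\to j$ a morphism $D_d:D_i\to D_j$. A natural transformation $\tau:E\Rightarrow D$ of diagrams is a family $\tau_i:E_i\to D_i$ with $\tau_j\circ E_d=D_d\circ\tau_i$ for every edge $d:i\to j$; it is cartesian if all these squares are pullbacks. Let $\kappa:D\Rightarrow\Delta S$ be a colimiting cocone of $D$. Pulling back along the components $\kappa_i$ defines a functor $\kappa^*$ from the slice category $\mathcal G/S$ to the full subcategory of the slice category $\mathcal G^I/D$ on the cartesian natural transformations, and $\kappa$ is called Van Kampen if $\kappa^*$ is an equivalence of categories. Let $X$ be an object of $\mathcal B$, and regard the sets $D_i(X)$ as pairwise disjoint. A path segment of sort $X$ is a triple $(y,\delta,y')$ where either $\delta=d$ is an edge $i\to j$ of $I$, $y\in D_i(X)$ and $y'=D_d(y)\in D_j(X)$, or $\delta=d^{op}$ is the formal opposite of such an edge,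 $y'\in D_i(X)$ and $y=D_d(y')\in D_j(X)$. Two segments are weakly equal if they are equal or one is the reverse $(y',\delta^{op},y)$ of the other $(y,\delta,y')$, where $(d^{op})^{op}=d$. A mapping path of sort $X$ from $z$ to $z'$ is a finite sequence $[(y_0,\delta_0,y_1),(y_1,\delta_1,y_2),\dots,(y_{n-1},\delta_{n-1},y_n)]$ of path segments of sort $X$ with $n\ge 1$, $y_0=z$ and $y_n=z'$, or, if $z=z'$, the empty sequence ($n=0$). It is proper if the segments at any two different positions are not weakly equal, and inner-cycle free if $y_i\ne y_j$ whenever $0\le i<j\le n$ and $j-i\le n-1$. Two mapping paths are disjoint if no segment of the one is weakly equal to a segment of the other. The following are equivalent: 1. $\kappa$ is Van Kampen. 2. For all objects $X$ of $\mathcal B$, all vertices $i,j$ of $I$ and all $z\in D_i(X)$, $z'\in D_j(X)$, there are no two different proper mapping paths from $z$ to $z'$. 3. For all such $X,i,j,z,z'$, there are no two different proper mapping paths from $z$ to $z'$ that are disjoint. 4. For all such $X,i,j,z,z'$, there are no two different proper mapping paths from $z$ to $z'$ that are disjoint and both inner-cycle free. -/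

import Mathlib

open CategoryTheory

universe u v w₁ w₂ u₁ v₁

namespace VanKampenPath

/-! ### Diagrams over a multigraph

A directed multigraph is a quiver `I`; a diagram in `C` is a graph morphism `I ⥤q C` into the
underlying graph of `C`. -/

section Diagrams

variable {I : Type w₁} [Quiver.{w₂} I] {C : Type u₁} [Category.{v₁} C]

/-- A natural transformation between diagrams: one component for each vertex, and one naturality
square for each edge. -/
@[ext]
structure DiagramHom (E D : I ⥤q C) where
  app (i : I) : E.obj i ⟶ D.obj i
  naturality {i j : I} (d : i ⟶ j) : E.map d ≫ app j = app i ≫ D.map d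

/-- The category of diagrams over the multigraph `I` in `C`. -/
instance diagramCategory : Category (I ⥤q C) where
  Hom := DiagramHom
  id D := { app := fun i => 𝟙 (D.obj i), naturality := by simp }
  comp σ τ :=
    { app := fun i => σ.app i ≫ τ.app i
      naturality := fun d => by
        rw [← Category.assoc, σ.naturality, Category.assoc, τ.naturality, Category.assoc] }
  id_comp τ := by ext; simp
  comp_id τ := by ext; simp
  assoc ρ σ τ := by ext; simp

@[ext]
theorem diagramHom_ext {E D : I ⥤q C} {σ τ : E ⟶ D} (h : ∀ i, σ.app i = τ.app i) : σ = τ :=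
  DiagramHom.ext (funext h)

@[simp]
theorem id_app (D : I ⥤q C) (i : I) : DiagramHom.app (𝟙 D) i = 𝟙 (D.obj i) := rfl

@[simp]
theorem comp_app {F E D : I ⥤q C} (σ : F ⟶ E) (τ : E ⟶ D) (i : I) :
    (σ ≫ τ).app i = σ.app i ≫ τ.app i := rfl

/-- The constant diagram at `S`, sending each edge to the identity of `S`. -/
@[simps]
def constDiagram (I : Type w₁) [Quiver.{w₂} I] (S : C) : I ⥤q C where
  obj _ := S
  map _ := 𝟙 S

/-- A commutative cocone over `D` with vertex `S` is a natural transformation from `D` to the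
constant diagram at `S`. -/
abbrev DiagramCocone (D : I ⥤q C) (S : C) := D ⟶ constDiagram I S

/-- The component at `i` of a cocone, as a morphism to its vertex. -/
def leg {D : I ⥤q C} {S : C} (κ : DiagramCocone D S) (i : I) : D.obj i ⟶ S := κ.app i

theorem leg_w {D : I ⥤q C} {S : C} (κ : DiagramCocone D S) {i j : I} (d : i ⟶ j) :
    D.map d ≫ leg κ j = leg κ i :=
  (κ.naturality d).trans (Category.comp_id _)

/-- A cocone is colimiting if it is universal. -/
def IsColimiting {D : I ⥤q C} {S : C} (κ : DiagramCocone D S) : Prop :=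
  ∀ (T : C) (ρ : DiagramCocone D T), ∃! u : S ⟶ T, ∀ i : I, leg κ i ≫ u = leg ρ i

/-- A natural transformation is cartesian if all its naturality squares are pullbacks. -/
def IsCartesian {E D : I ⥤q C} (τ : E ⟶ D) : Prop :=
  ∀ ⦃i j : I⦄ (d : i ⟶ j), IsPullback (E.map d) (τ.app i) (τ.app j) (D.map d)

/-- The full subcategory of the slice category over `D` on the cartesian transformations. -/
abbrev CartesianOver (D : I ⥤q C) :=
  ObjectProperty.FullSubcategory (fun τ : Over D => IsCartesian τ.hom)

variable [Limits.HasPullbacks C]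

/-- The diagram obtained by pulling back `σ : K ⟶ S` along all components of the cocone `κ`. -/
noncomputable def pullbackDiagram {D : I ⥤q C} {S : C} (κ : DiagramCocone D S) (σ : Over S) :
    I ⥤q C where
  obj i := Limits.pullback (leg κ i) σ.hom
  map {i j} d := Limits.pullback.lift
    (Limits.pullback.fst (leg κ i) σ.hom ≫ D.map d)
    (Limits.pullback.snd (leg κ i) σ.hom)
    (by rw [Category.assoc, leg_w κ d]; exact Limits.pullback.condition)

section PullbackDiagram

variable {D : I ⥤q C} {S : C} (κ : DiagramCocone D S) (σ : Over S)

/-- The projection of the pullback of `σ` along `leg κ i` to `D.obj i`. -/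
noncomputable def pbFst (i : I) : (pullbackDiagram κ σ).obj i ⟶ D.obj i :=
  Limits.pullback.fst (leg κ i) σ.hom

/-- The projection of the pullback of `σ` along `leg κ i` to the domain of `σ`. -/
noncomputable def pbSnd (i : I) : (pullbackDiagram κ σ).obj i ⟶ σ.left :=
  Limits.pullback.snd (leg κ i) σ.hom

theorem pb_isPullback (i : I) : IsPullback (pbSnd κ σ i) (pbFst κ σ i) σ.hom (leg κ i) :=
  (IsPullback.of_hasPullback (leg κ i) σ.hom).flip

theorem map_pbFst {i j : I} (d : i ⟶ j) :
    (pullbackDiagram κ σ).map d ≫ pbFst κ σ j = pbFst κ σ i ≫ D.map d :=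
  Limits.pullback.lift_fst _ _ _

theorem map_pbSnd {i j : I} (d : i ⟶ j) :
    (pullbackDiagram κ σ).map d ≫ pbSnd κ σ j = pbSnd κ σ i :=
  Limits.pullback.lift_snd _ _ _

/-- The transformation whose component at `i` is the pullback of `σ` along `leg κ i`. -/
noncomputable def pullbackProj : pullbackDiagram κ σ ⟶ D where
  app i := pbFst κ σ i
  naturality d := map_pbFst κ σ d

theorem pullbackProj_isCartesian : IsCartesian (pullbackProj κ σ) := by
  intro i j d
  refine IsPullback.of_right ?_ (map_pbFst κ σ d) (pb_isPullback κ σ j)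
  rw [map_pbSnd, leg_w]
  exact pb_isPullback κ σ i

variable {σ} {σ' : Over S} (γ : σ ⟶ σ')

/-- The component at `i` of the action of pulling back along `κ` on a morphism of the slice
category over `S`: the universal arrow into the pullback. -/
noncomputable def pbMap (i : I) : (pullbackDiagram κ σ).obj i ⟶ (pullbackDiagram κ σ').obj i :=
  (pb_isPullback κ σ' i).lift (pbSnd κ σ i ≫ γ.left) (pbFst κ σ i)
    (by rw [Category.assoc, Over.w]; exact (pb_isPullback κ σ i).w)

@[simp]
theorem pbMap_pbFst (i : I) : pbMap κ γ i ≫ pbFst κ σ' i = pbFst κ σ i :=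
  (pb_isPullback κ σ' i).lift_snd _ _ _

@[simp]
theorem pbMap_pbSnd (i : I) : pbMap κ γ i ≫ pbSnd κ σ' i = pbSnd κ σ i ≫ γ.left :=
  (pb_isPullback κ σ' i).lift_fst _ _ _

/-- The action of pulling back along `κ` on a morphism of the slice category over `S`. -/
noncomputable def pullbackMap : pullbackDiagram κ σ ⟶ pullbackDiagram κ σ' where
  app i := pbMap κ γ i
  naturality {i j} d := by
    apply (pb_isPullback κ σ' j).hom_ext
    · rw [Category.assoc, Category.assoc, pbMap_pbSnd, map_pbSnd, pbMap_pbSnd,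
        ← Category.assoc, map_pbSnd]
    · rw [Category.assoc, Category.assoc, pbMap_pbFst, map_pbFst, map_pbFst,
        ← Category.assoc, pbMap_pbFst]

end PullbackDiagram

/-- The functor pulling back along the cocone `κ`, from the slice category over `S` to the
category of cartesian transformations into `D`. -/
noncomputable def pullbackAlong {D : I ⥤q C} {S : C} (κ : DiagramCocone D S) :
    Over S ⥤ CartesianOver D where
  obj σ := ⟨Over.mk (pullbackProj κ σ), pullbackProj_isCartesian κ σ⟩
  map γ := ObjectProperty.homMk (Over.homMk (pullbackMap κ γ) (by
    ext i
    exact pbMap_pbFst κ γ i))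
  map_id σ := by
    ext i
    change pbMap κ (𝟙 σ) i = 𝟙 _
    apply (pb_isPullback κ σ i).hom_ext <;> simp
  map_comp {_ _ σ''} γ γ' := by
    ext i
    change pbMap κ (γ ≫ γ') i = pbMap κ γ i ≫ pbMap κ γ' i
    apply (pb_isPullback κ σ'' i).hom_ext
    · rw [Category.assoc, pbMap_pbSnd, pbMap_pbSnd, ← Category.assoc, pbMap_pbSnd,
        Over.comp_left, Category.assoc]
    · simp

/-- A cocone is Van Kampen if pulling back along it is an equivalence of categories. -/
def IsVanKampen {D : I ⥤q C} {S : C} (κ : DiagramCocone D S) : Prop :=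
  (pullbackAlong κ).IsEquivalence

end Diagrams

/-! ### Mapping paths -/

section Paths

variable {I : Type w₁} [Quiver.{w₂} I] {B : Type u} [SmallCategory.{u} B]

/-- The elements of sort `X` of a diagram of presheaves: the disjoint union of the sets
`D_i(X)`. -/
abbrev Element (D : I ⥤q (B ⥤ Type u)) (X : B) := Σ i : I, (D.obj i).obj X

/-- The edges `d` of `I` together with their formal opposites. -/
inductive SignedEdge (I : Type w₁) [Quiver.{w₂} I] : Type (max w₁ w₂)
  | fwd {i j : I} (d : i ⟶ j) : SignedEdge I
  | bwd {i j : I} (d : i ⟶ j) : SignedEdge I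

/-- The formal opposite of a signed edge. -/
def SignedEdge.op : SignedEdge I → SignedEdge I
  | fwd d => bwd d
  | bwd d => fwd d

/-- `MapsTo d y y'` says that `y` is an element of the source component of the edge `d`, and that
`D_d` maps it to `y'`. -/
def MapsTo (D : I ⥤q (B ⥤ Type u)) {X : B} {i j : I} (d : i ⟶ j) (y y' : Element D X) : Prop :=
  ∃ x : (D.obj i).obj X, y = ⟨i, x⟩ ∧ y' = ⟨j, (D.map d).app X x⟩

/-- The condition on a triple `(y, δ, y')` to be a path segment. -/
def IsSegment (D : I ⥤q (B ⥤ Type u)) {X : B} (y : Element D X) (δ : SignedEdge I)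
    (y' : Element D X) : Prop :=
  match δ with
  | .fwd d => MapsTo D d y y'
  | .bwd d => MapsTo D d y' y

/-- Path segments of sort `X`. -/
@[ext]
structure PathSegment (D : I ⥤q (B ⥤ Type u)) (X : B) where
  first : Element D X
  label : SignedEdge I
  third : Element D X
  valid : IsSegment D first label third

variable {D : I ⥤q (B ⥤ Type u)} {X : B}

/-- The path segment `(y', δ.op, y)` obtained from `(y, δ, y')`. -/
def PathSegment.reverse (s : PathSegment D X) : PathSegment D X where
  first := s.third
  label := s.label.op
  third := s.first
  valid := by
    obtain ⟨y, δ, y', h⟩ := s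
    cases δ <;> exact h

/-- Weak equality of path segments: equality up to reversal. -/
def WeaklyEqual (s t : PathSegment D X) : Prop := s = t ∨ s = t.reverse

/-- `Connects P z z'` says that the sequence `P` of path segments is a mapping path, i.e. the third
component of each segment is the first component of its successor, and that it connects `z` with
`z'`. The empty path connects each element with itself. -/
def Connects : List (PathSegment D X) → Element D X → Element D X → Prop
  | [], z, z' => z = z'
  | s :: P, z, z' => s.first = z ∧ Connects P s.third z'

/-- A path is proper if its segments at any two different positions are not weakly equal. -/
def IsProper (P : List (PathSegment D X)) : Prop := P.Pairwise fun s t => ¬ WeaklyEqual s t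

/-- No segment of `P` is weakly equal to a segment of `Q`. -/
def PathsDisjoint (P Q : List (PathSegment D X)) : Prop :=
  ∀ s ∈ P, ∀ t ∈ Q, ¬ WeaklyEqual s t

/-- The list `y₀, y₁, …, yₙ` of the elements visited by a non-empty path. -/
def pathElements : List (PathSegment D X) → List (Element D X)
  | [] => []
  | s :: P => s.first :: (s :: P).map PathSegment.third

/-- A path of length `n` is inner-cycle free if `yᵢ ≠ yⱼ` for all `0 ≤ i < j ≤ n` with
`j - i ≤ n - 1`. -/
def IsInnerCycleFree (P : List (PathSegment D X)) : Prop :=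
  ∀ i j : ℕ, i < j → j ≤ P.length → j < i + P.length →
    (pathElements P)[i]? ≠ (pathElements P)[j]?

end Paths

end VanKampenPath

/-!
Evaluating at an object `X` of `B`, the elements of sort `X` of `D` form a graph whose edges are the
path segments, and `κ` is colimiting if and only if `S(X)` is the set of its connected components.
A cartesian transformation `τ : E ⟶ D` is a covering of these graphs: paths lift uniquely. Since
colimits of sets are stable under pullback, `κ^*` is always fully faithful, and `τ` lies in its
image exactly if a connected component of `E` contains at most one element over each element of
`D`, that is, if all coverings of `D` have trivial monodromy.

If the graphs contain no closed trail, each closed path backtracks, and removing the backtracking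
segments shows that the monodromy is trivial. Conversely, given a closed trail through a segment
`s`, the double covering whose sheets are exchanged along `s` only has nontrivial monodromy. Right
Kan extension along `X` makes this covering of graphs of sort `X` a cartesian transformation.
-/

namespace VanKampenPath

section MappingPaths

variable {I : Type w₁} [Quiver.{w₂} I] {B : Type u} [SmallCategory.{u} B]
  {D : I ⥤q (B ⥤ Type u)} {X : B} {P Q : List (PathSegment D X)} {x y z : Element D X}

theorem SignedEdge.op_op (δ : SignedEdge I) : δ.op.op = δ := by cases δ <;> rfl

@[simp]
theorem PathSegment.reverse_reverse (s : PathSegment D X) : s.reverse.reverse = s :=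
  PathSegment.ext rfl (SignedEdge.op_op _) rfl

theorem WeaklyEqual.symm {s t : PathSegment D X} (h : WeaklyEqual s t) : WeaklyEqual t s := by
  rcases h with rfl | rfl
  · exact Or.inl rfl
  · exact Or.inr t.reverse_reverse.symm

theorem weaklyEqual_reverse_right {s t : PathSegment D X} :
    WeaklyEqual s t.reverse ↔ WeaklyEqual s t := by
  simp only [WeaklyEqual, PathSegment.reverse_reverse]
  exact or_comm

theorem weaklyEqual_reverse_reverse {s t : PathSegment D X} :
    WeaklyEqual s.reverse t.reverse ↔ WeaklyEqual s t := by
  rw [weaklyEqual_reverse_right]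
  exact ⟨fun h => (weaklyEqual_reverse_right.1 h.symm).symm,
    fun h => (weaklyEqual_reverse_right.2 h.symm).symm⟩

theorem connects_singleton (s : PathSegment D X) : Connects [s] s.first s.third := ⟨rfl, rfl⟩

theorem connects_append : Connects (P ++ Q) x z ↔ ∃ y, Connects P x y ∧ Connects Q y z := by
  induction P generalizing x with
  | nil => exact ⟨fun h => ⟨x, rfl, h⟩, fun ⟨_, hP, hQ⟩ => hP ▸ hQ⟩
  | cons s P ih =>
    refine (and_congr_right' ih).trans ⟨?_, ?_⟩
    · exact fun ⟨hs, y, hP, hQ⟩ => ⟨y, ⟨hs, hP⟩, hQ⟩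
    · exact fun ⟨y, ⟨hs, hP⟩, hQ⟩ => ⟨hs, y, hP, hQ⟩

theorem Connects.append (hP : Connects P x y) (hQ : Connects Q y z) : Connects (P ++ Q) x z :=
  connects_append.2 ⟨y, hP, hQ⟩

theorem connects_append_cons {s : PathSegment D X} :
    Connects (P ++ s :: Q) x z ↔ Connects P x s.first ∧ Connects Q s.third z := by
  rw [connects_append]
  exact ⟨fun ⟨_, hP, hs, hQ⟩ => ⟨hs ▸ hP, hQ⟩, fun ⟨hP, hQ⟩ => ⟨_, hP, rfl, hQ⟩⟩

theorem Connects.apply_eq {α : Type*} {φ : Element D X → α} (hP : Connects P x y)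
    (hφ : ∀ s ∈ P, φ s.first = φ s.third) : φ x = φ y := by
  induction P generalizing x with
  | nil => exact congrArg φ hP
  | cons s P ih =>
    obtain ⟨rfl, hP⟩ := hP
    rw [List.forall_mem_cons] at hφ
    exact hφ.1.trans (ih hP hφ.2)

/-- The mapping path `P` traversed backwards. -/
def reversePath (P : List (PathSegment D X)) : List (PathSegment D X) :=
  (P.map PathSegment.reverse).reverse

theorem Connects.reversePath (hP : Connects P x y) : Connects (reversePath P) y x := by
  induction P generalizing x with
  | nil => exact Eq.symm hP
  | cons s P ih =>
    obtain ⟨rfl, hP⟩ := hP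
    simp only [VanKampenPath.reversePath, List.map_cons, List.reverse_cons]
    exact (ih hP).append (connects_singleton s.reverse)

theorem IsProper.sublist (hQ : IsProper Q) (h : P.Sublist Q) : IsProper P :=
  List.Pairwise.sublist h hQ

theorem IsProper.append_reversePath (hP : IsProper P) (hQ : IsProper Q) (hd : PathsDisjoint P Q) :
    IsProper (P ++ reversePath Q) := by
  refine List.pairwise_append.2 ⟨hP, ?_, fun s hs t ht hst => ?_⟩
  · refine List.pairwise_reverse.2 (List.pairwise_map.2 (hQ.imp fun h h' => h ?_))
    exact (weaklyEqual_reverse_reverse.1 h').symm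
  · obtain ⟨t, htQ, rfl⟩ := List.mem_map.1 (List.mem_reverse.1 ht)
    exact hd s hs t htQ (weaklyEqual_reverse_right.1 hst)

/-- The graph of elements of sort `X`, whose edges are the path segments up to weak equality, is a
forest: it has no nonempty closed trail. -/
def NoProperCycle (D : I ⥤q (B ⥤ Type u)) (X : B) : Prop :=
  ∀ (P : List (PathSegment D X)) (z : Element D X), Connects P z z → IsProper P → P = []

theorem NoProperCycle.eq_nil_of_pathsDisjoint (h : NoProperCycle D X) (hP : Connects P x y)
    (hQ : Connects Q x y) (hP' : IsProper P) (hQ' : IsProper Q) (hd : PathsDisjoint P Q) :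
    P = [] ∧ Q = [] := by
  simpa [VanKampenPath.reversePath] using
    h _ x (hP.append hQ.reversePath) (hP'.append_reversePath hQ' hd)

theorem NoProperCycle.eq_of_connects (h : NoProperCycle D X) (P Q : List (PathSegment D X))
    {x y : Element D X} (hP : Connects P x y) (hQ : Connects Q x y) (hP' : IsProper P)
    (hQ' : IsProper Q) : P = Q := by
  by_cases hd : PathsDisjoint P Q
  · obtain ⟨rfl, rfl⟩ := h.eq_nil_of_pathsDisjoint hP hQ hP' hQ' hd
    rfl
  · simp only [PathsDisjoint, not_forall, not_not] at hd
    obtain ⟨s, hs, t, ht, hst⟩ := hd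
    obtain ⟨P₁, P₂, rfl⟩ := List.append_of_mem hs
    obtain ⟨Q₁, Q₂, rfl⟩ := List.append_of_mem ht
    obtain ⟨hP₁, hP₂⟩ := connects_append_cons.1 hP
    obtain ⟨hQ₁, hQ₂⟩ := connects_append_cons.1 hQ
    rcases hst with rfl | rfl
    · have initial : P₁ = Q₁ :=
        h.eq_of_connects P₁ Q₁ hP₁ hQ₁ (hP'.sublist (by simp)) (hQ'.sublist (by simp))
      have final : P₂ = Q₂ :=
        h.eq_of_connects P₂ Q₂ hP₂ hQ₂ (hP'.sublist (by simp)) (hQ'.sublist (by simp))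
      rw [initial, final]
    · -- `Q₁` ends with the reverse of `t`, which is the next segment of `Q`.
      have initial : P₁ ++ [t.reverse] = Q₁ :=
        h.eq_of_connects _ Q₁ (connects_append_cons.2 ⟨hP₁, rfl⟩) hQ₁
          (hP'.sublist (by simp)) (hQ'.sublist (by simp))
      subst initial
      exact absurd (Or.inr rfl)
        ((List.pairwise_append.1 hQ').2.2 t.reverse (by simp) t List.mem_cons_self)
termination_by P.length + Q.length
decreasing_by
  all_goals
    subst_vars
    simp only [List.length_append, List.length_cons, List.length_nil]
    omega

theorem Connects.split (hP : Connects P x z) {n : ℕ}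
    (hy : (x :: P.map PathSegment.third)[n]? = some y) :
    Connects (P.take n) x y ∧ Connects (P.drop n) y z := by
  induction P generalizing x n with
  | nil =>
    obtain ⟨rfl, rfl⟩ : n = 0 ∧ x = y := by simpa [List.getElem?_singleton] using hy
    exact ⟨rfl, hP⟩
  | cons s P ih =>
    cases n with
    | zero =>
      obtain rfl : x = y := by simpa using hy
      exact ⟨rfl, hP⟩
    | succ n =>
      obtain ⟨initial, final⟩ := ih hP.2 (by simpa using hy)
      exact ⟨⟨hP.1, initial⟩, final⟩

theorem pathElements_eq_cons (hP : Connects P x y) (hne : P ≠ []) :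
    pathElements P = x :: P.map PathSegment.third := by
  cases P with
  | nil => exact absurd rfl hne
  | cons s P => rw [← hP.1]; rfl

theorem Connects.exists_shorter_cycle (hP : Connects P x y) (hc : ¬ IsInnerCycleFree P) :
    ∃ (Q : List (PathSegment D X)) (z : Element D X),
      Connects Q z z ∧ Q.Sublist P ∧ Q ≠ [] ∧ Q.length < P.length := by
  simp only [IsInnerCycleFree, not_forall, ne_eq, not_not] at hc
  obtain ⟨i, j, hij, hj, hlen, heq⟩ := hc
  obtain ⟨k, rfl⟩ := Nat.exists_eq_add_of_lt hij
  rw [pathElements_eq_cons hP (List.ne_nil_of_length_pos (by omega))] at heq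
  obtain ⟨z, hz⟩ : ∃ z, (x :: P.map PathSegment.third)[i + k + 1]? = some z :=
    ⟨_, List.getElem?_eq_getElem (by simpa using hj)⟩
  have final := (hP.split (heq.trans hz)).2
  have cycle := (final.split (n := k + 1) (y := z) (by simpa [add_comm] using hz)).1
  refine ⟨_, z, cycle, (List.take_sublist _ _).trans (List.drop_sublist _ _), ?_, ?_⟩
  · exact List.ne_nil_of_length_pos (by simp only [List.length_take, List.length_drop]; omega)
  · simp only [List.length_take, List.length_drop]; omega

theorem exists_isInnerCycleFree_cycle (P : List (PathSegment D X)) {x : Element D X}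
    (hP : Connects P x x) (hP' : IsProper P) (hne : P ≠ []) :
    ∃ (Q : List (PathSegment D X)) (y : Element D X),
      Connects Q y y ∧ IsProper Q ∧ Q ≠ [] ∧ IsInnerCycleFree Q := by
  by_cases hc : IsInnerCycleFree P
  · exact ⟨P, x, hP, hP', hne, hc⟩
  · obtain ⟨Q, y, hQ, hsub, hQne, _⟩ := hP.exists_shorter_cycle hc
    exact exists_isInnerCycleFree_cycle Q hQ (hP'.sublist hsub) hQne
termination_by P.length

end MappingPaths

section Cocones

variable {I : Type w₁} [Quiver.{w₂} I] {C : Type u₁} [Category.{v₁} C] {D E : I ⥤q C} {S T : C}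
  {κ : DiagramCocone D S}

/-- The isomorphism of diagrams whose components are given isomorphisms. -/
def diagramIsoOfComponents (α : ∀ i, E.obj i ≅ D.obj i)
    (hα : ∀ {i j : I} (d : i ⟶ j), E.map d ≫ (α j).hom = (α i).hom ≫ D.map d) : E ≅ D where
  hom := { app i := (α i).hom, naturality := hα }
  inv :=
    { app i := (α i).inv
      naturality d := by rw [Iso.comp_inv_eq, Category.assoc, hα, Iso.inv_hom_id_assoc] }
  hom_inv_id := by ext i : 1; exact (α i).hom_inv_id
  inv_hom_id := by ext i : 1; exact (α i).inv_hom_id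

/-- The cocone with given legs. -/
def mkCocone (l : ∀ i, D.obj i ⟶ S) (hl : ∀ {i j : I} (d : i ⟶ j), D.map d ≫ l j = l i) :
    DiagramCocone D S where
  app := l
  naturality d := (hl d).trans (Category.comp_id _).symm

theorem IsColimiting.hom_ext (hκ : IsColimiting κ) {f g : S ⟶ T}
    (h : ∀ i, leg κ i ≫ f = leg κ i ≫ g) : f = g :=
  (hκ T (mkCocone (fun i => leg κ i ≫ g) fun d => by rw [← Category.assoc, leg_w])).unique
    h fun _ => rfl

variable [Limits.HasPullbacks C]

/-- The cocone over the pullback of `D` along `σ` induced by `κ`. -/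
noncomputable def pullbackCocone (κ : DiagramCocone D S) (σ : Over S) :
    DiagramCocone (pullbackDiagram κ σ) σ.left :=
  mkCocone (pbSnd κ σ) (map_pbSnd κ σ)

/-- The cocone `κ` is a universal colimit: each of its pullbacks is colimiting. -/
def IsUniversal (κ : DiagramCocone D S) : Prop :=
  ∀ σ : Over S, IsColimiting (pullbackCocone κ σ)

theorem IsUniversal.faithful_pullbackAlong (hκ : IsUniversal κ) : (pullbackAlong κ).Faithful where
  map_injective {σ σ'} γ γ' h := by
    ext1
    refine (hκ σ).hom_ext fun i => ?_
    have h' : pbMap κ γ i = pbMap κ γ' i :=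
      congrArg (fun f => DiagramHom.app (CommaMorphism.left (InducedCategory.Hom.hom f)) i) h
    change pbSnd κ σ i ≫ γ.left = pbSnd κ σ i ≫ γ'.left
    rw [← pbMap_pbSnd, h', pbMap_pbSnd]

theorem IsUniversal.full_pullbackAlong (hκ : IsUniversal κ) : (pullbackAlong κ).Full where
  map_surjective {σ σ'} φ := by
    let ψ : pullbackDiagram κ σ ⟶ pullbackDiagram κ σ' := φ.hom.left
    have hψ (i : I) : ψ.app i ≫ pbFst κ σ' i = pbFst κ σ i :=
      congrArg (fun f => DiagramHom.app f i) (Over.w φ.hom)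
    obtain ⟨f, hf, -⟩ := hκ σ _ (ψ ≫ pullbackCocone κ σ')
    replace hf (i : I) : pbSnd κ σ i ≫ f = ψ.app i ≫ pbSnd κ σ' i := hf i
    have hfσ : f ≫ σ'.hom = σ.hom := (hκ σ).hom_ext fun i => by
      change pbSnd κ σ i ≫ f ≫ σ'.hom = pbSnd κ σ i ≫ σ.hom
      rw [← Category.assoc, hf, Category.assoc, (pb_isPullback κ σ' i).w, ← Category.assoc, hψ,
        (pb_isPullback κ σ i).w]
    refine ⟨Over.homMk f hfσ, ?_⟩
    ext i : 3
    change pbMap κ (Over.homMk f hfσ) i = ψ.app i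
    apply (pb_isPullback κ σ' i).hom_ext
    · rw [pbMap_pbSnd]
      exact hf i
    · rw [pbMap_pbFst, hψ]

theorem exists_isPullback_of_mem_essImage {τ : E ⟶ D} {hτ : IsCartesian τ}
    (h : (pullbackAlong κ).essImage ⟨Over.mk τ, hτ⟩) :
    ∃ (K : C) (ρ : DiagramCocone E K) (f : K ⟶ S),
      ∀ i, IsPullback (leg ρ i) (τ.app i) f (leg κ i) := by
  obtain ⟨σ, ⟨φ⟩⟩ := h
  let ψ : Over.mk (pullbackProj κ σ) ≅ Over.mk τ := (ObjectProperty.ι _).mapIso φ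
  let α : pullbackDiagram κ σ ≅ E := (Over.forget _).mapIso ψ
  let β (i : I) : (pullbackDiagram κ σ).obj i ≅ E.obj i :=
    { hom := α.hom.app i
      inv := α.inv.app i
      hom_inv_id := congrArg (fun f => DiagramHom.app f i) α.hom_inv_id
      inv_hom_id := congrArg (fun f => DiagramHom.app f i) α.inv_hom_id }
  have hβ (i : I) : (β i).hom ≫ τ.app i = pbFst κ σ i :=
    congrArg (fun f => DiagramHom.app f i) (Over.w ψ.hom)
  refine ⟨σ.left, α.inv ≫ pullbackCocone κ σ, σ.hom, fun i => ?_⟩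
  refine IsPullback.of_iso (pb_isPullback κ σ i) (β i) (Iso.refl _) (Iso.refl _) (Iso.refl _)
    ?_ ?_ (by simp) (by simp)
  · rw [Iso.refl_hom, Category.comp_id]
    exact ((β i).hom_inv_id_assoc (pbSnd κ σ i)).symm
  · rw [Iso.refl_hom, Category.comp_id, hβ]

theorem mem_essImage_of_isPullback {τ : E ⟶ D} (hτ : IsCartesian τ) {K : C}
    {ρ : DiagramCocone E K} {f : K ⟶ S} (h : ∀ i, IsPullback (leg ρ i) (τ.app i) f (leg κ i)) :
    (pullbackAlong κ).essImage ⟨Over.mk τ, hτ⟩ := by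
  let σ : Over S := Over.mk f
  let α (i : I) : (pullbackDiagram κ σ).obj i ≅ E.obj i :=
    (pb_isPullback κ σ i).isoIsPullback _ _ (h i)
  have hα₁ (i : I) : (α i).hom ≫ leg ρ i = pbSnd κ σ i := IsPullback.isoIsPullback_hom_fst ..
  have hα₂ (i : I) : (α i).hom ≫ τ.app i = pbFst κ σ i := IsPullback.isoIsPullback_hom_snd ..
  have hα {i j : I} (d : i ⟶ j) :
      (pullbackDiagram κ σ).map d ≫ (α j).hom = (α i).hom ≫ E.map d := by
    apply (h j).hom_ext
    · rw [Category.assoc, Category.assoc, hα₁, map_pbSnd, leg_w, hα₁]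
    · rw [Category.assoc, Category.assoc, hα₂, map_pbFst, τ.naturality, ← Category.assoc, hα₂]
  refine ⟨σ, ⟨ObjectProperty.isoMk _ (Over.isoMk (diagramIsoOfComponents α hα) ?_)⟩⟩
  ext i : 1
  exact hα₂ i

end Cocones

section Elements

variable {I : Type w₁} [Quiver.{w₂} I] {B : Type u} [SmallCategory.{u} B]
  {D E : I ⥤q (B ⥤ Type u)} {S : B ⥤ Type u} {X : B}

/-- The segment traversing the edge `d` forwards from `x`. -/
def edgeSegment (D : I ⥤q (B ⥤ Type u)) {i j : I} (d : i ⟶ j) (x : (D.obj i).obj X) :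
    PathSegment D X where
  first := ⟨i, x⟩
  label := .fwd d
  third := ⟨j, (D.map d).app X x⟩
  valid := ⟨x, rfl, rfl⟩

theorem PathSegment.exists_eq_edgeSegment (s : PathSegment D X) :
    ∃ (i j : I) (d : i ⟶ j) (x : (D.obj i).obj X),
      s = edgeSegment D d x ∨ s = (edgeSegment D d x).reverse := by
  obtain ⟨y, δ, y', h⟩ := s
  cases δ <;> obtain ⟨x, rfl, rfl⟩ := h
  · exact ⟨_, _, _, x, Or.inl rfl⟩
  · exact ⟨_, _, _, x, Or.inr rfl⟩

theorem PathSegment.apply_first_eq {α : Type*} {φ : Element D X → α}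
    (hφ : ∀ {i j : I} (d : i ⟶ j) (x : (D.obj i).obj X), φ ⟨j, (D.map d).app X x⟩ = φ ⟨i, x⟩)
    (s : PathSegment D X) : φ s.first = φ s.third := by
  obtain ⟨i, j, d, x, rfl | rfl⟩ := s.exists_eq_edgeSegment
  · exact (hφ d x).symm
  · exact hφ d x

/-- The value of a cocone at an element. -/
def coconeValue (κ : DiagramCocone D S) (e : Element D X) : S.obj X := (leg κ e.1).app X e.2

theorem coconeValue_map (κ : DiagramCocone D S) {i j : I} (d : i ⟶ j) (x : (D.obj i).obj X) :
    coconeValue κ ⟨j, (D.map d).app X x⟩ = coconeValue κ ⟨i, x⟩ :=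
  ConcreteCategory.congr_hom (NatTrans.congr_app (leg_w κ d) X) x

/-- The action of a transformation of diagrams on elements. -/
def mapElement (τ : E ⟶ D) (e : Element E X) : Element D X := ⟨e.1, (τ.app e.1).app X e.2⟩

theorem mapElement_map (τ : E ⟶ D) {i j : I} (d : i ⟶ j) (x : (E.obj i).obj X) :
    mapElement τ ⟨j, (E.map d).app X x⟩ = ⟨j, (D.map d).app X ((τ.app i).app X x)⟩ :=
  congrArg (Sigma.mk (β := fun j => (D.obj j).obj X) j)
    (ConcreteCategory.congr_hom (NatTrans.congr_app (τ.naturality d) X) x)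

/-- The action of a transformation of diagrams on path segments. -/
def PathSegment.map (τ : E ⟶ D) (s : PathSegment E X) : PathSegment D X where
  first := mapElement τ s.first
  label := s.label
  third := mapElement τ s.third
  valid := by
    obtain ⟨y, δ, y', h⟩ := s
    cases δ <;> obtain ⟨x, rfl, rfl⟩ := h <;>
      exact ⟨(τ.app _).app X x, rfl, mapElement_map τ _ x⟩

theorem Connects.map (τ : E ⟶ D) {P : List (PathSegment E X)} {x y : Element E X}
    (hP : Connects P x y) :
    Connects (P.map (PathSegment.map τ)) (mapElement τ x) (mapElement τ y) := by
  induction P generalizing x with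
  | nil => exact congrArg (mapElement τ) hP
  | cons s P ih =>
    obtain ⟨rfl, hP⟩ := hP
    exact ⟨rfl, ih hP⟩

section Cartesian

variable {τ : E ⟶ D}

theorem IsCartesian.segment_ext (hτ : IsCartesian τ) {s t : PathSegment E X}
    (hst : s.map τ = t.map τ) (hfirst : s.first = t.first) : s = t := by
  have hlabel : s.label = t.label := congrArg (·.label) hst
  have hthird : mapElement τ s.third = mapElement τ t.third := congrArg (·.third) hst
  refine PathSegment.ext hfirst hlabel ?_
  obtain ⟨y, δ, z, hs⟩ := s
  obtain ⟨_, _, z', ht⟩ := t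
  subst hfirst hlabel
  cases δ with
  | fwd d =>
    obtain ⟨x, rfl, rfl⟩ := hs
    obtain ⟨x', hx, rfl⟩ := ht
    obtain rfl := sigma_mk_injective hx
    rfl
  | bwd d =>
    obtain ⟨x, rfl, rfl⟩ := hs
    obtain ⟨x', rfl, hx⟩ := ht
    obtain rfl := Limits.Types.ext_of_isPullback ((hτ d).app X) (eq_of_heq (Sigma.mk.inj hx).2)
      (eq_of_heq (Sigma.mk.inj hthird).2)
    rfl

theorem IsCartesian.exists_segment_lift (hτ : IsCartesian τ) {e : Element E X}
    {s : PathSegment D X} (hs : s.first = mapElement τ e) :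
    ∃ t : PathSegment E X, t.first = e ∧ t.map τ = s := by
  obtain ⟨k, y⟩ := e
  obtain ⟨i, j, d, x, rfl | rfl⟩ := s.exists_eq_edgeSegment <;>
    obtain ⟨rfl, hx⟩ := Sigma.mk.inj_iff.1 hs
  · obtain rfl := eq_of_heq hx
    exact ⟨edgeSegment E d y, rfl, PathSegment.ext rfl rfl (mapElement_map τ d y)⟩
  · obtain ⟨x', rfl, rfl⟩ :=
      Limits.Types.exists_of_isPullback ((hτ d).app X) y x (eq_of_heq hx).symm
    exact ⟨(edgeSegment E d x').reverse, rfl, PathSegment.ext (mapElement_map τ d x') rfl rfl⟩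

theorem IsCartesian.exists_lift (hτ : IsCartesian τ) {P : List (PathSegment D X)}
    {e : Element E X} {z : Element D X} (hP : Connects P (mapElement τ e) z) :
    ∃ (Q : List (PathSegment E X)) (e' : Element E X),
      Connects Q e e' ∧ Q.map (PathSegment.map τ) = P ∧ mapElement τ e' = z := by
  induction P generalizing e with
  | nil => exact ⟨[], e, rfl, rfl, hP⟩
  | cons s P ih =>
    obtain ⟨t, rfl, rfl⟩ := hτ.exists_segment_lift hP.1
    obtain ⟨Q, e', hQ, rfl, he'⟩ := ih hP.2
    exact ⟨t :: Q, e', ⟨rfl, hQ⟩, rfl, he'⟩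

end Cartesian

/-- Elements are connected if they lie in the same connected component of the graph whose edges are
the path segments. -/
def Connected (x y : Element D X) : Prop := ∃ P : List (PathSegment D X), Connects P x y

theorem Connected.refl (x : Element D X) : Connected x x := ⟨[], rfl⟩

theorem Connected.symm {x y : Element D X} : Connected x y → Connected y x :=
  fun ⟨_, hP⟩ => ⟨_, hP.reversePath⟩

theorem Connected.trans {x y z : Element D X} : Connected x y → Connected y z → Connected x z :=
  fun ⟨_, hP⟩ ⟨_, hQ⟩ => ⟨_, hP.append hQ⟩

theorem connected_map {i j : I} (d : i ⟶ j) (x : (D.obj i).obj X) :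
    Connected (⟨i, x⟩ : Element D X) ⟨j, (D.map d).app X x⟩ :=
  ⟨_, connects_singleton (edgeSegment D d x)⟩

theorem Connected.apply_eq {α : Type*} {φ : Element D X → α}
    (hφ : ∀ {i j : I} (d : i ⟶ j) (x : (D.obj i).obj X), φ ⟨j, (D.map d).app X x⟩ = φ ⟨i, x⟩)
    {x y : Element D X} : Connected x y → φ x = φ y :=
  fun ⟨_, hP⟩ => hP.apply_eq fun s _ => s.apply_first_eq hφ

theorem Connected.coconeValue_eq (κ : DiagramCocone D S) {x y : Element D X} (h : Connected x y) :
    coconeValue κ x = coconeValue κ y :=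
  h.apply_eq (coconeValue_map κ)

theorem IsCartesian.exists_connected_lift {τ : E ⟶ D} (hτ : IsCartesian τ) {e : Element E X}
    {z : Element D X} : Connected (mapElement τ e) z → ∃ e', Connected e e' ∧ mapElement τ e' = z :=
  fun ⟨_, hP⟩ =>
    let ⟨Q, e', hQ, _, he'⟩ := hτ.exists_lift hP
    ⟨e', ⟨Q, hQ⟩, he'⟩

/-- The action of a morphism of `B` on elements. -/
def actElement {Y : B} (f : X ⟶ Y) (e : Element D X) : Element D Y := ⟨e.1, (D.obj e.1).map f e.2⟩

theorem actElement_id (e : Element D X) : actElement (𝟙 X) e = e :=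
  Sigma.ext rfl (heq_of_eq (Functor.map_id_apply _ _ _))

theorem actElement_comp {Y Z : B} (f : X ⟶ Y) (g : Y ⟶ Z) (e : Element D X) :
    actElement (f ≫ g) e = actElement g (actElement f e) :=
  Sigma.ext rfl (heq_of_eq (Functor.map_comp_apply _ _ _ _))

theorem coconeValue_actElement (κ : DiagramCocone D S) {Y : B} (f : X ⟶ Y) (e : Element D X) :
    coconeValue κ (actElement f e) = S.map f (coconeValue κ e) :=
  NatTrans.naturality_apply (leg κ e.1) f e.2

end Elements

section Colimits

variable {I : Type w₁} [Quiver.{w₂} I] {B : Type u} [SmallCategory.{u} B]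
  {D : I ⥤q (B ⥤ Type u)} {S : B ⥤ Type u} {κ : DiagramCocone D S} {X : B}

/-- The functor cofreely generated by the set `A` at the object `X`, that is, the right Kan
extension of `A` along the inclusion of `X` into `B`. -/
def cofree (A : Type) (X : B) : B ⥤ Type u where
  obj Y := (Y ⟶ X) → A
  map f := TypeCat.ofHom fun a g => a (f ≫ g)
  map_id Y := by ext a; simp
  map_comp f g := by ext a; simp

/-- The universal property of `cofree`. -/
def cofreeEquiv (F : B ⥤ Type u) (A : Type) (X : B) : (F ⟶ cofree A X) ≃ (F.obj X → A) where
  toFun α x := α.app X x (𝟙 X)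
  invFun φ :=
    { app Y := TypeCat.ofHom fun x g => φ (F.map g x)
      naturality Y Z f := by
        ext x
        refine funext fun g => ?_
        simp [cofree] }
  left_inv α := by
    ext Y x
    refine funext fun g => ?_
    have naturality : α.app X (F.map g x) (𝟙 X) = α.app Y x (g ≫ 𝟙 X) :=
      congrFun (NatTrans.naturality_apply α g x) (𝟙 X)
    rwa [Category.comp_id] at naturality
  right_inv φ := by
    funext x
    change φ (F.map (𝟙 X) x) = φ x
    rw [Functor.map_id_apply]

theorem IsColimiting.existsUnique_desc (hκ : IsColimiting κ) {A : Type} {φ : Element D X → A}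
    (hφ : ∀ {i j : I} (d : i ⟶ j) (x : (D.obj i).obj X), φ ⟨j, (D.map d).app X x⟩ = φ ⟨i, x⟩) :
    ∃! f : S.obj X → A, ∀ e, f (coconeValue κ e) = φ e := by
  let ρ : DiagramCocone D (cofree A X) :=
    mkCocone (fun i => (cofreeEquiv _ A X).symm fun x => φ ⟨i, x⟩) fun {i j} d => by
      refine (cofreeEquiv _ A X).injective ?_
      rw [Equiv.apply_symm_apply]
      refine funext fun x => Eq.trans ?_ (hφ d x)
      exact congrFun ((cofreeEquiv _ A X).apply_symm_apply fun x => φ ⟨j, x⟩) ((D.map d).app X x)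
  refine ((cofreeEquiv S A X).existsUnique_congr fun f => ?_).1 (hκ _ ρ)
  rw [Sigma.forall]
  exact forall_congr' fun i => (Equiv.eq_symm_apply _).trans funext_iff

theorem IsColimiting.coconeValue_surjective (hκ : IsColimiting κ) :
    Function.Surjective (coconeValue κ (X := X)) := fun s => by
  have image_eq : (fun s => ∃ e : Element D X, coconeValue κ e = s) = fun _ => True :=
    (hκ.existsUnique_desc (φ := fun _ => True) fun _ _ => rfl).unique
      (fun e => eq_true ⟨e, rfl⟩) fun _ => rfl
  exact of_eq_true (congrFun image_eq s)

theorem IsColimiting.coconeValue_eq_iff (hκ : IsColimiting κ) {x y : Element D X} :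
    coconeValue κ x = coconeValue κ y ↔ Connected x y := by
  refine ⟨fun h => ?_, Connected.coconeValue_eq κ⟩
  obtain ⟨f, hf, -⟩ := hκ.existsUnique_desc (φ := Connected x) fun d y => propext
    ⟨fun h => h.trans (connected_map d y).symm, fun h => h.trans (connected_map d y)⟩
  rw [← hf, ← h, hf]
  exact Connected.refl x

theorem isColimiting_of_surjective_of_connected
    (hsurj : ∀ X : B, Function.Surjective (coconeValue κ (X := X)))
    (hconn : ∀ (X : B) (x y : Element D X), coconeValue κ x = coconeValue κ y → Connected x y) :
    IsColimiting κ := by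
  intro T ρ
  choose r hr using hsurj
  have desc_coconeValue {X : B} (e : Element D X) :
      coconeValue ρ (r X (coconeValue κ e)) = coconeValue ρ e :=
    (hconn X _ e (hr X _)).coconeValue_eq ρ
  refine ⟨{ app X := TypeCat.ofHom fun s => coconeValue ρ (r X s)
            naturality X Y f := ?_ }, fun i => ?_, fun f hf => ?_⟩
  · ext s
    change coconeValue ρ (r Y (S.map f s)) = T.map f (coconeValue ρ (r X s))
    conv_lhs => rw [← hr X s, ← coconeValue_actElement, desc_coconeValue, coconeValue_actElement]
  · ext X x
    exact desc_coconeValue ⟨i, x⟩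
  · ext X s
    change f.app X s = coconeValue ρ (r X s)
    conv_lhs => rw [← hr X s]
    exact ConcreteCategory.congr_hom (NatTrans.congr_app (hf (r X s).1) X) (r X s).2

/-- The relation of being connected, as a setoid. -/
def connectedSetoid (D : I ⥤q (B ⥤ Type u)) (X : B) : Setoid (Element D X) where
  r := Connected
  iseqv := ⟨Connected.refl, Connected.symm, Connected.trans⟩

/-- The set of connected components of the graph of elements of sort `X`. -/
abbrev Components (D : I ⥤q (B ⥤ Type u)) (X : B) := Quotient (connectedSetoid D X)

theorem Connected.actElement {Y : B} (f : X ⟶ Y) {x y : Element D X} (h : Connected x y) :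
    Connected (actElement f x) (actElement f y) := by
  refine Quotient.exact (s := connectedSetoid D Y) (h.apply_eq (φ := fun e =>
    (Quotient.mk _ (VanKampenPath.actElement f e) : Components D Y)) fun {i j} d x => ?_)
  refine Quotient.sound' (Connected.symm ?_)
  have := connected_map d ((D.obj i).map f x)
  rwa [NatTrans.naturality_apply] at this

/-- The functor of connected components, which becomes a colimit of `D` when it is shrunk to the
universe `u`. -/
def componentsFunctor (D : I ⥤q (B ⥤ Type u)) : B ⥤ Type (max w₁ u) where
  obj := Components D
  map f := TypeCat.ofHom (Quotient.map (actElement f) fun _ _ h => h.actElement f)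
  map_id X := by
    ext c
    obtain ⟨e, rfl⟩ := Quotient.exists_rep c
    exact congrArg (Quotient.mk _) (actElement_id e)
  map_comp f g := by
    ext c
    obtain ⟨e, rfl⟩ := Quotient.exists_rep c
    exact congrArg (Quotient.mk _) (actElement_comp f g e)

theorem shrink_map_equivShrink {C : Type*} [Category C] {F : C ⥤ Type*}
    [FunctorToTypes.Small.{u} F] {X Y : C} (f : X ⟶ Y) (x : F.obj X) :
    (FunctorToTypes.shrink.{u} F).map f (equivShrink _ x) = equivShrink _ (F.map f x) := by
  simp

theorem exists_isColimiting [FunctorToTypes.Small.{u} (componentsFunctor D)] :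
    ∃ (K : B ⥤ Type u) (ρ : DiagramCocone D K), IsColimiting ρ := by
  let ρ : DiagramCocone D (FunctorToTypes.shrink.{u} (componentsFunctor D)) := mkCocone
    (fun i =>
      { app X := TypeCat.ofHom fun x =>
          equivShrink.{u} ((componentsFunctor D).obj X) (Quotient.mk (connectedSetoid D X) ⟨i, x⟩)
        naturality X Y f := by
          ext x
          exact (shrink_map_equivShrink (F := componentsFunctor D) f
            (Quotient.mk (connectedSetoid D X) ⟨i, x⟩)).symm })
    fun {i j} d => by
      ext X x
      exact congrArg (equivShrink.{u} ((componentsFunctor D).obj X))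
        (Quotient.sound' (connected_map d x).symm)
  refine ⟨_, ρ, isColimiting_of_surjective_of_connected (fun X k => ?_) fun X x y h => ?_⟩
  · obtain ⟨c, rfl⟩ := (equivShrink _).surjective k
    obtain ⟨e, rfl⟩ := Quotient.exists_rep c
    exact ⟨e, rfl⟩
  · exact Quotient.exact ((equivShrink ((componentsFunctor D).obj X)).injective h)

end Colimits

section Descent

variable {I : Type w₁} [Quiver.{w₂} I] {B : Type u} [SmallCategory.{u} B]
  {D E : I ⥤q (B ⥤ Type u)} {K S : B ⥤ Type u} {κ : DiagramCocone D S} {ρ : DiagramCocone E K}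
  {τ : E ⟶ D} {f : K ⟶ S} {X : B}

theorem coconeValue_mapElement (hf : ∀ i, leg ρ i ≫ f = τ.app i ≫ leg κ i) (e : Element E X) :
    coconeValue κ (mapElement τ e) = f.app X (coconeValue ρ e) :=
  (ConcreteCategory.congr_hom (NatTrans.congr_app (hf e.1) X) e.2).symm

theorem element_ext_of_isPullback (h : ∀ i, IsPullback (leg ρ i) (τ.app i) f (leg κ i))
    {e e' : Element E X} (hρ : coconeValue ρ e = coconeValue ρ e')
    (hτ : mapElement τ e = mapElement τ e') : e = e' := by
  obtain ⟨i, x⟩ := e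
  obtain ⟨j, y⟩ := e'
  obtain ⟨rfl, hxy⟩ := Sigma.mk.inj_iff.1 hτ
  exact congrArg (Sigma.mk i) (Limits.Types.ext_of_isPullback ((h i).app X) hρ (eq_of_heq hxy))

theorem IsColimiting.isUniversal (hκ : IsColimiting κ) : IsUniversal κ := by
  intro σ
  have isPullback (i : I) :
      IsPullback (leg (pullbackCocone κ σ) i) ((pullbackProj κ σ).app i) σ.hom (leg κ i) :=
    pb_isPullback κ σ i
  refine isColimiting_of_surjective_of_connected (fun X k => ?_) fun X e e' h => ?_
  · obtain ⟨⟨i, z⟩, hz⟩ := hκ.coconeValue_surjective (σ.hom.app X k)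
    obtain ⟨e, he, -⟩ := Limits.Types.exists_of_isPullback ((isPullback i).app X) k z hz.symm
    exact ⟨⟨i, e⟩, he⟩
  · have connected :
        Connected (mapElement (pullbackProj κ σ) e) (mapElement (pullbackProj κ σ) e') := by
      rw [← hκ.coconeValue_eq_iff, coconeValue_mapElement fun i => (isPullback i).w, h,
        coconeValue_mapElement fun i => (isPullback i).w]
    obtain ⟨e'', he'', hmap⟩ := (pullbackProj_isCartesian κ σ).exists_connected_lift connected
    obtain rfl : e'' = e' :=
      element_ext_of_isPullback isPullback ((he''.coconeValue_eq _).symm.trans h) hmap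
    exact he''

/-- A cartesian transformation, seen as a covering of graphs, has trivial monodromy if a connected
component of its domain contains at most one element over each element of its codomain. -/
def HasTrivialMonodromy (τ : E ⟶ D) : Prop :=
  ∀ ⦃X : B⦄ ⦃e e' : Element E X⦄, Connected e e' → mapElement τ e = mapElement τ e' → e = e'

theorem hasTrivialMonodromy_of_isPullback (h : ∀ i, IsPullback (leg ρ i) (τ.app i) f (leg κ i)) :
    HasTrivialMonodromy τ :=
  fun _ _ _ he => element_ext_of_isPullback h (he.coconeValue_eq ρ)

theorem IsCartesian.isPullback_of_hasTrivialMonodromy (hτ : IsCartesian τ) (hκ : IsColimiting κ)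
    (hρ : IsColimiting ρ) (hf : ∀ i, leg ρ i ≫ f = τ.app i ≫ leg κ i)
    (hmono : HasTrivialMonodromy τ) (i : I) : IsPullback (leg ρ i) (τ.app i) f (leg κ i) := by
  refine IsPullback.of_forall_isPullback_app fun X => (Limits.Types.isPullback_iff _ _ _ _).2
    ⟨NatTrans.congr_app (hf i) X, fun x y ⟨hxy, hxy'⟩ => ?_, fun k z hk => ?_⟩
  · have connected : Connected (⟨i, x⟩ : Element E X) ⟨i, y⟩ := hρ.coconeValue_eq_iff.1 hxy
    exact eq_of_heq (Sigma.mk.inj (hmono connected (Sigma.ext rfl (heq_of_eq hxy')))).2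
  · obtain ⟨e, rfl⟩ := hρ.coconeValue_surjective k
    have connected : Connected (mapElement τ e) ⟨i, z⟩ :=
      hκ.coconeValue_eq_iff.1 ((coconeValue_mapElement hf e).trans hk)
    obtain ⟨⟨j, x⟩, hx, hz⟩ := hτ.exists_connected_lift connected
    obtain ⟨rfl, hz⟩ := Sigma.mk.inj_iff.1 hz
    exact ⟨x, (hx.coconeValue_eq ρ).symm, eq_of_heq hz⟩

theorem IsCartesian.small_components (hτ : IsCartesian τ) (hκ : IsColimiting κ) (X : B) :
    Small.{u} (Components E X) := by
  obtain ⟨r, hr⟩ := (hκ.coconeValue_surjective (X := X)).hasRightInverse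
  refine small_of_surjective (α := Σ s : S.obj X, (E.obj (r s).1).obj X)
    (f := fun p => Quotient.mk _ ⟨(r p.1).1, p.2⟩) fun c => ?_
  obtain ⟨e, rfl⟩ := Quotient.exists_rep c
  have connected : Connected (mapElement τ e) (r (coconeValue κ (mapElement τ e))) :=
    hκ.coconeValue_eq_iff.1 (hr _).symm
  obtain ⟨⟨i, x⟩, hx, hi⟩ := hτ.exists_connected_lift connected
  obtain rfl : i = (r (coconeValue κ (mapElement τ e))).1 := congrArg Sigma.fst hi
  exact ⟨⟨_, x⟩, Quotient.sound' hx.symm⟩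

theorem IsColimiting.mem_essImage_pullbackAlong_iff (hκ : IsColimiting κ) (hτ : IsCartesian τ) :
    (pullbackAlong κ).essImage ⟨Over.mk τ, hτ⟩ ↔ HasTrivialMonodromy τ := by
  refine ⟨fun h => ?_, fun h => ?_⟩
  · obtain ⟨K, ρ, f, hf⟩ := exists_isPullback_of_mem_essImage h
    exact hasTrivialMonodromy_of_isPullback hf
  · have : FunctorToTypes.Small.{u} (componentsFunctor E) := hτ.small_components hκ
    obtain ⟨K, ρ, hρ⟩ := exists_isColimiting (D := E)
    obtain ⟨f, hf, -⟩ := hρ S (τ ≫ κ)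
    exact mem_essImage_of_isPullback hτ (hτ.isPullback_of_hasTrivialMonodromy hκ hρ hf h)

theorem IsColimiting.isVanKampen_iff_hasTrivialMonodromy (hκ : IsColimiting κ) :
    IsVanKampen κ ↔
      ∀ (E : I ⥤q (B ⥤ Type u)) (τ : E ⟶ D), IsCartesian τ → HasTrivialMonodromy τ := by
  refine ⟨fun h E τ hτ => ?_, fun h => ?_⟩
  · exact (hκ.mem_essImage_pullbackAlong_iff hτ).1 (h.essSurj.mem_essImage _)
  · exact
      { faithful := hκ.isUniversal.faithful_pullbackAlong
        full := hκ.isUniversal.full_pullbackAlong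
        essSurj.mem_essImage := fun ⟨⟨E, ⟨⟨⟩⟩, τ⟩, hτ⟩ =>
          (hκ.mem_essImage_pullbackAlong_iff hτ).2 (h E τ hτ) }

end Descent

section Monodromy

variable {I : Type w₁} [Quiver.{w₂} I] {B : Type u} [SmallCategory.{u} B]
  {D E : I ⥤q (B ⥤ Type u)} {τ : E ⟶ D} {X : B}

theorem exists_eq_append_of_not_pairwise {α : Type*} {R : α → α → Prop} {l : List α}
    (h : ¬ l.Pairwise R) :
    ∃ (l₁ : List α) (a : α) (l₂ : List α) (b : α) (l₃ : List α),
      l = l₁ ++ a :: (l₂ ++ b :: l₃) ∧ ¬ R a b := by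
  simp only [List.pairwise_iff_forall_sublist, not_forall] at h
  obtain ⟨a, b, hsub, hab⟩ := h
  obtain ⟨l, l', rfl, ha, hb⟩ := List.cons_sublist_iff.1 hsub
  obtain ⟨l₁, l₂, rfl⟩ := List.append_of_mem ha
  obtain ⟨l₂', l₃, rfl⟩ := List.append_of_mem (List.singleton_sublist.1 hb)
  exact ⟨l₁, a, l₂ ++ l₂', b, l₃, by simp, hab⟩

theorem IsCartesian.eq_of_connects (hτ : IsCartesian τ) (hD : NoProperCycle D X)
    (P : List (PathSegment E X)) {e e' : Element E X} (hP : Connects P e e')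
    (he : mapElement τ e = mapElement τ e') : e = e' := by
  by_cases hproper : IsProper (P.map (PathSegment.map τ))
  · obtain rfl : P = [] := List.map_eq_nil_iff.1 (hD _ _ (he ▸ hP.map τ) hproper)
    exact hP
  · rw [IsProper, List.pairwise_map] at hproper
    obtain ⟨P₁, s, P₂, t, P₃, rfl, hst⟩ := exists_eq_append_of_not_pairwise hproper
    obtain ⟨hP₁, hP⟩ := connects_append_cons.1 hP
    obtain ⟨hP₂, hP₃⟩ := connects_append_cons.1 hP
    rcases not_not.1 hst with hst | hst
    · have hfirst : s.first = t.first :=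
        hτ.eq_of_connects hD (s :: P₂) ⟨rfl, hP₂⟩ (congrArg (·.first) hst)
      rw [hfirst] at hP₁
      exact hτ.eq_of_connects hD (P₁ ++ t :: P₃) (connects_append_cons.2 ⟨hP₁, hP₃⟩) he
    · have hthird : s.third = t.first := hτ.eq_of_connects hD P₂ hP₂ (congrArg (·.third) hst)
      have backtracks : s.reverse = t :=
        hτ.segment_ext ((congrArg (·.reverse) hst).trans (t.map τ).reverse_reverse) hthird
      rw [← backtracks] at hP₃
      exact hτ.eq_of_connects hD (P₁ ++ P₃) (hP₁.append hP₃) he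
termination_by P.length
decreasing_by
  all_goals
    subst_vars
    simp only [List.length_append, List.length_cons]
    omega

theorem IsCartesian.hasTrivialMonodromy (hτ : IsCartesian τ) (hD : ∀ X, NoProperCycle D X) :
    HasTrivialMonodromy τ :=
  fun X _ _ ⟨P, hP⟩ => hτ.eq_of_connects (hD X) P hP

end Monodromy

section DoubleCover

variable {I : Type w₁} [Quiver.{w₂} I] {B : Type u} [SmallCategory.{u} B]
  {D : I ⥤q (B ⥤ Type u)} {X : B}

open Classical in
/-- Whether the edge `d` at `x` is the segment `s`, up to reversal. -/
noncomputable def isMarked (s : PathSegment D X) {i j : I} (d : i ⟶ j) (x : (D.obj i).obj X) :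
    Bool :=
  decide (WeaklyEqual s (edgeSegment D d x))

/-- The double cover of the graph of elements of sort `X` whose sheets are exchanged along the
segment `s` only, extended to all sorts by right Kan extension along `X`: an element of sort `Y`
over `x` selects a sheet over `g x` for each `g : Y ⟶ X`. -/
noncomputable def doubleCover (s : PathSegment D X) : I ⥤q (B ⥤ Type u) where
  obj i :=
    { obj Y := (D.obj i).obj Y × ((Y ⟶ X) → Bool)
      map f := TypeCat.ofHom fun p => ((D.obj i).map f p.1, fun g => p.2 (f ≫ g))
      map_id Y := by ext p <;> simp
      map_comp f g := by ext p <;> simp }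
  map {i j} d :=
    { app Y := TypeCat.ofHom fun p =>
        ((D.map d).app Y p.1, fun g => xor (p.2 g) (isMarked s d ((D.obj i).map g p.1)))
      naturality Y Z f := by
        ext p
        · exact NatTrans.naturality_apply (D.map d) f p.1
        · simp }

/-- The covering map of `doubleCover s`. -/
noncomputable def doubleCoverProj (s : PathSegment D X) : doubleCover s ⟶ D where
  app i := { app Y := TypeCat.ofHom Prod.fst }
  naturality d := rfl

theorem doubleCoverProj_isCartesian (s : PathSegment D X) : IsCartesian (doubleCoverProj s) := by
  intro i j d
  refine IsPullback.of_forall_isPullback_app fun Y => (Limits.Types.isPullback_iff _ _ _ _).2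
    ⟨rfl, fun p q ⟨hmap, hproj⟩ => ?_, fun q x hx => ?_⟩
  · obtain ⟨x, a⟩ := p
    obtain ⟨y, b⟩ := q
    obtain rfl : x = y := hproj
    refine Prod.ext rfl (funext fun g => ?_)
    exact Bool.xor_left_inj.1 (congrFun (congrArg Prod.snd hmap) g)
  · obtain ⟨y, b⟩ := q
    obtain rfl : y = (D.map d).app Y x := hx
    refine ⟨(x, fun g => xor (b g) (isMarked s d ((D.obj i).map g x))), ?_, rfl⟩
    refine Prod.ext rfl (funext fun g => ?_)
    exact (Bool.xor_assoc _ _ _).trans (by rw [Bool.xor_self, Bool.xor_false])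

/-- The sheet of the double cover on which an element of sort `X` lies. -/
def sheet {s : PathSegment D X} (e : Element (doubleCover s) X) : Bool := e.2.2 (𝟙 X)

theorem sheet_first_eq_sheet_third_iff {s : PathSegment D X} (t : PathSegment (doubleCover s) X) :
    sheet t.first = sheet t.third ↔ ¬ WeaklyEqual s (t.map (doubleCoverProj s)) := by
  obtain ⟨i, j, d, ⟨x, a⟩, ht⟩ := t.exists_eq_edgeSegment
  have sheet_third : sheet (edgeSegment (doubleCover s) d (x, a)).third =
      xor (a (𝟙 X)) (isMarked s d x) := by
    change xor (a (𝟙 X)) (isMarked s d ((D.obj i).map (𝟙 X) x)) = _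
    rw [Functor.map_id_apply]
  have sheet_eq_iff : sheet (edgeSegment (doubleCover s) d (x, a)).first =
      sheet (edgeSegment (doubleCover s) d (x, a)).third ↔ ¬ WeaklyEqual s (edgeSegment D d x) := by
    rw [sheet_third]
    change a (𝟙 X) = _ ↔ _
    cases a (𝟙 X) <;> simp [isMarked]
  rcases ht with rfl | rfl
  · exact sheet_eq_iff
  · exact eq_comm.trans (sheet_eq_iff.trans (not_congr weaklyEqual_reverse_right.symm))

theorem noProperCycle_of_hasTrivialMonodromy
    (h : ∀ s : PathSegment D X, HasTrivialMonodromy (doubleCoverProj s)) : NoProperCycle D X := by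
  rintro (_ | ⟨s, P⟩) z hP hproper
  · rfl
  · let e : Element (doubleCover s) X := ⟨z.1, (z.2, fun _ => false)⟩
    obtain ⟨_ | ⟨t, Q⟩, e', hQ, hlift, he'⟩ :=
      (doubleCoverProj_isCartesian s).exists_lift (e := e) hP
    · cases hlift
    · obtain ⟨ht, rfl⟩ := List.cons_eq_cons.1 hlift
      have closed : e = e' := h s ⟨_, hQ⟩ he'.symm
      have rest : sheet t.third = sheet e' := hQ.2.apply_eq fun t' ht' =>
        (sheet_first_eq_sheet_third_iff t').2
          ((List.pairwise_cons.1 hproper).1 _ (List.mem_map_of_mem ht'))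
      have unswitched : sheet t.first = sheet t.third := by rw [hQ.1, rest, closed]
      exact absurd (Or.inl ht.symm) ((sheet_first_eq_sheet_third_iff t).1 unswitched)

theorem IsColimiting.isVanKampen_iff_noProperCycle {S : B ⥤ Type u} {κ : DiagramCocone D S}
    (hκ : IsColimiting κ) : IsVanKampen κ ↔ ∀ X, NoProperCycle D X := by
  rw [hκ.isVanKampen_iff_hasTrivialMonodromy]
  refine ⟨fun h X => ?_, fun h E τ hτ => hτ.hasTrivialMonodromy h⟩
  exact noProperCycle_of_hasTrivialMonodromy fun s => h _ _ (doubleCoverProj_isCartesian s)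

end DoubleCover

end VanKampenPath

theorem corollary6p2_general {B : Type u} [SmallCategory.{u} B]
    {I : Type w₁} [Quiver.{w₂} I]
    (D : I ⥤q (B ⥤ Type u)) (S : B ⥤ Type u)
    (κ : VanKampenPath.DiagramCocone D S) (hκ : VanKampenPath.IsColimiting κ) :
    List.TFAE [
      VanKampenPath.IsVanKampen κ,
      ∀ (X : B) (i j : I) (z : (D.obj i).obj X) (z' : (D.obj j).obj X),
        ¬ ∃ P Q : List (VanKampenPath.PathSegment D X),
          VanKampenPath.Connects P ⟨i, z⟩ ⟨j, z'⟩ ∧ VanKampenPath.Connects Q ⟨i, z⟩ ⟨j, z'⟩ ∧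
          VanKampenPath.IsProper P ∧ VanKampenPath.IsProper Q ∧ P ≠ Q,
      ∀ (X : B) (i j : I) (z : (D.obj i).obj X) (z' : (D.obj j).obj X),
        ¬ ∃ P Q : List (VanKampenPath.PathSegment D X),
          VanKampenPath.Connects P ⟨i, z⟩ ⟨j, z'⟩ ∧ VanKampenPath.Connects Q ⟨i, z⟩ ⟨j, z'⟩ ∧
          VanKampenPath.IsProper P ∧ VanKampenPath.IsProper Q ∧ P ≠ Q ∧
          VanKampenPath.PathsDisjoint P Q,
      ∀ (X : B) (i j : I) (z : (D.obj i).obj X) (z' : (D.obj j).obj X),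
        ¬ ∃ P Q : List (VanKampenPath.PathSegment D X),
          VanKampenPath.Connects P ⟨i, z⟩ ⟨j, z'⟩ ∧ VanKampenPath.Connects Q ⟨i, z⟩ ⟨j, z'⟩ ∧
          VanKampenPath.IsProper P ∧ VanKampenPath.IsProper Q ∧ P ≠ Q ∧
          VanKampenPath.PathsDisjoint P Q ∧
          VanKampenPath.IsInnerCycleFree P ∧ VanKampenPath.IsInnerCycleFree Q] := by
  tfae_have 1 → 2 := fun h X i j z z' ⟨P, Q, hP, hQ, hP', hQ', hne⟩ =>
    hne ((hκ.isVanKampen_iff_noProperCycle.1 h X).eq_of_connects P Q hP hQ hP' hQ')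
  tfae_have 2 → 3 := fun h X i j z z' ⟨P, Q, hP, hQ, hP', hQ', hne, _⟩ =>
    h X i j z z' ⟨P, Q, hP, hQ, hP', hQ', hne⟩
  tfae_have 3 → 4 := fun h X i j z z' ⟨P, Q, hP, hQ, hP', hQ', hne, hd, _⟩ =>
    h X i j z z' ⟨P, Q, hP, hQ, hP', hQ', hne, hd⟩
  tfae_have 4 → 1 := by
    refine fun h => hκ.isVanKampen_iff_noProperCycle.2 fun X P z hP hP' => ?_
    by_contra hne
    obtain ⟨Q, y, hQ, hQ', hQne, hQc⟩ :=
      VanKampenPath.exists_isInnerCycleFree_cycle P hP hP' hne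
    exact h X y.1 y.1 y.2 y.2 ⟨[], Q, rfl, hQ, List.Pairwise.nil, hQ', hQne.symm,
      fun _ hs => absurd hs List.not_mem_nil,
      fun _ _ hij hj => absurd (hij.trans_le hj) (Nat.not_lt_zero _), hQc⟩
  tfae_finish

theorem corollary6p2 {B : Type u} [SmallCategory.{u} B]
    {I : Type w₁} [Quiver.{w₂} I] [Finite I] [∀ i j : I, Finite (i ⟶ j)]
    (D : I ⥤q (B ⥤ Type u)) (S : B ⥤ Type u)
    (κ : VanKampenPath.DiagramCocone D S) (hκ : VanKampenPath.IsColimiting κ) :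
    List.TFAE [
      VanKampenPath.IsVanKampen κ,
      ∀ (X : B) (i j : I) (z : (D.obj i).obj X) (z' : (D.obj j).obj X),
        ¬ ∃ P Q : List (VanKampenPath.PathSegment D X),
          VanKampenPath.Connects P ⟨i, z⟩ ⟨j, z'⟩ ∧ VanKampenPath.Connects Q ⟨i, z⟩ ⟨j, z'⟩ ∧
          VanKampenPath.IsProper P ∧ VanKampenPath.IsProper Q ∧ P ≠ Q,
      ∀ (X : B) (i j : I) (z : (D.obj i).obj X) (z' : (D.obj j).obj X),
        ¬ ∃ P Q : List (VanKampenPath.PathSegment D X),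
          VanKampenPath.Connects P ⟨i, z⟩ ⟨j, z'⟩ ∧ VanKampenPath.Connects Q ⟨i, z⟩ ⟨j, z'⟩ ∧
          VanKampenPath.IsProper P ∧ VanKampenPath.IsProper Q ∧ P ≠ Q ∧
          VanKampenPath.PathsDisjoint P Q,
      ∀ (X : B) (i j : I) (z : (D.obj i).obj X) (z' : (D.obj j).obj X),
        ¬ ∃ P Q : List (VanKampenPath.PathSegment D X),
          VanKampenPath.Connects P ⟨i, z⟩ ⟨j, z'⟩ ∧ VanKampenPath.Connects Q ⟨i, z⟩ ⟨j, z'⟩ ∧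
          VanKampenPath.IsProper P ∧ VanKampenPath.IsProper Q ∧ P ≠ Q ∧
          VanKampenPath.PathsDisjoint P Q ∧
          VanKampenPath.IsInnerCycleFree P ∧ VanKampenPath.IsInnerCycleFree Q] :=
  corollary6p2_general D S κ hκ
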